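/- Let $n\ge 0$, $\mathcal B=\{0,1\}^n\subseteq\mathbb R^n$, and let $f:\mathcal B\to\mathbb R$ be submodular, i.e. $f(x\vee y)+f(x\wedge y)\le f(x)+f(y)$ for all $x,y\in\mathcal B$ (coordinatewise maximum and minimum), with $f(\mathbf 0)=0$. Put $$\mathrm{hyp}_{\mathcal B}(f)=\{(x,t)\in\mathcal B\times\mathbb R: t\le f(x)\},\qquad \mathrm{gra}_{\mathcal B}(f)=\{(x,t)\in\mathcal B\times\mathbb R: f(x)=t\},$$ let $EP_f=\{s\in\mathbb R^n: s\cdot x\le f(x)\ \text{for all } x\in\mathcal B\}$ be the extended polymatroid of $f$, let $\mathrm{ext}(EP_f)$ be its set of extreme points, and let $$\mathcal E_f=\{(x,t)\in\mathbb R^{n}\times\mathbb R: s\cdot x\le t\ \text{for all } s\in\mathrm{ext}(EP_f)\}$$ be the extended envelope epigraph of $f$. For a set $S\subseteq\mathbb R^{n+1}$, a set $C\subseteq\mathbb R^{n+1}$ is called $S$-free if $C$ is closed and convex and $\mathrm{int}(C)\cap S=\varnothing$; it is maximally $S$-free if it is $S$-free and is not properly contained in another $S$-free set. A polyhedron is the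 solution set of finitely many linear inequalities, and a facet of $C$ is a nonempty face (the set of maximizers over $C$ of a linear functional) of dimension $\dim C-1$. **Theorem.** Let $C\subseteq\mathbb R^{n+1}$ be a full-dimensional closed convex set with $\mathcal E_f\subseteq C$. Then $C$ is $\mathrm{hyp}_{\mathcal B}(f)$-free if and only if $C$ is $\mathrm{gra}_{\mathcal B}(f)$-free. Moreover, $C$ is maximally $\mathrm{hyp}_{\mathcal B}(f)$-free if and only if $C$ is $\mathrm{hyp}_{\mathcal B}(f)$-free, $C$ is a polyhedron, and every facet of $C$ has a point of $\mathrm{gra}_{\mathcal B}(f)$ in its relative interior. -/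

import Mathlib

open scoped Matrix

namespace SubmodularFree

/-- The Boolean hypercube `{0,1}ⁿ` as a subset of `ℝⁿ`. -/
def cube (n : ℕ) : Set (Fin n → ℝ) := {x | ∀ i, x i = 0 ∨ x i = 1}

/-- Submodularity of `f` on `{0,1}ⁿ`. Join and meet are the coordinatewise maximum and minimum,
i.e. union and intersection of the corresponding subsets of `[n]`. Values of `f` outside
`{0,1}ⁿ` play no role here or in any definition below. -/
def IsSubmodularOnCube {n : ℕ} (f : (Fin n → ℝ) → ℝ) : Prop :=
  ∀ x ∈ cube n, ∀ y ∈ cube n, f (x ⊔ y) + f (x ⊓ y) ≤ f x + f y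

/-- The hypograph of `f` over `{0,1}ⁿ`. -/
def hypCube {n : ℕ} (f : (Fin n → ℝ) → ℝ) : Set ((Fin n → ℝ) × ℝ) :=
  {p | p.1 ∈ cube n ∧ p.2 ≤ f p.1}

/-- The graph of `f` over `{0,1}ⁿ`. -/
def graCube {n : ℕ} (f : (Fin n → ℝ) → ℝ) : Set ((Fin n → ℝ) × ℝ) :=
  {p | p.1 ∈ cube n ∧ f p.1 = p.2}

/-- The extended polymatroid of `f`. -/
def extendedPolymatroid {n : ℕ} (f : (Fin n → ℝ) → ℝ) : Set (Fin n → ℝ) :=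
  {s | ∀ x ∈ cube n, s ⬝ᵥ x ≤ f x}

/-- The extended envelope epigraph of `f`: all `(x, t)` such that `s x ≤ t` for every
vertex `s` of the extended polymatroid. -/
def extendedEnvelopeEpigraph {n : ℕ} (f : (Fin n → ℝ) → ℝ) : Set ((Fin n → ℝ) × ℝ) :=
  {p | ∀ s ∈ (extendedPolymatroid f).extremePoints ℝ, s ⬝ᵥ p.1 ≤ p.2}

section General

variable {E : Type*} [AddCommGroup E] [Module ℝ E] [TopologicalSpace E]

/-- `C` is a (convex) `S`-free set: closed, convex, with no point of `S` in its interior. -/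
structure IsFree (S C : Set E) : Prop where
  isClosed : IsClosed C
  convex : Convex ℝ C
  disjoint : interior C ∩ S = ∅

/-- `C` is an inclusion-wise maximal `S`-free set. -/
def IsMaximalFree (S C : Set E) : Prop := Maximal (IsFree S) C

/-- A polyhedron: the solution set of finitely many (possibly zero) linear inequalities. -/
def IsPolyhedron (C : Set E) : Prop :=
  ∃ H : Finset ((E →L[ℝ] ℝ) × ℝ), C = {z | ∀ h ∈ H, h.1 z ≤ h.2}

/-- `F` is a facet of `C`: a nonempty face (the set of maximizers over `C` of a linear functional)
whose dimension is one less than the dimension of `C`. -/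
def IsFacet (C F : Set E) : Prop :=
  F.Nonempty ∧ IsExposed ℝ C F ∧
    Module.finrank ℝ (vectorSpan ℝ F) + 1 = Module.finrank ℝ (vectorSpan ℝ C)

end General

end SubmodularFree

namespace SubmodularFree

open Set Filter Topology

/-! ### Relative interiors, finite systems of inequalities, and maximal free sets. -/

section Polyhedra

variable {E : Type*} [NormedAddCommGroup E] [NormedSpace ℝ E]

/-! The envelope epigraph enters through the ray `(0, t)`, `t ≥ 0`. It makes upward a recession
direction of `C`, so an interior point of `C` in the hypograph lifts to an interior point on the
graph (`interior_upward`). Freeness and maximality can thus be tested on the finite graph.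

For finite `S`, separating each point of `S` from the interior shows that a maximal `S`-free set is
a polyhedron (`IsMaximalFree.isPolyhedron`). If a facet had no point of `S` in its relative
interior, its inequality could be relaxed slightly (`IsMaximalFree.facet_meets`). Conversely, an
`S`-free superset with a point beyond a facet would have that facet's point of `S` in its interior
(`IsFree.subset_of_facets_meet`). -/

theorem exists_add_smul_mem_of_mem_nhds {U : Set E} {z : E} (hU : U ∈ 𝓝 z) (v : E) :
    ∃ δ : ℝ, 0 < δ ∧ z + δ • v ∈ U := by
  have hcont : Tendsto (fun δ : ℝ => z + δ • v) (𝓝[>] 0) (𝓝 z) := by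
    have : Continuous fun δ : ℝ => z + δ • v := by fun_prop
    simpa using (this.tendsto 0).mono_left nhdsWithin_le_nhds
  obtain ⟨δ, hδ, hpos⟩ := ((hcont.eventually hU).and self_mem_nhdsWithin).exists
  exact ⟨δ, hpos, hδ⟩

theorem exists_add_smul_sub_mem_of_mem_intrinsicInterior {S : Set E} {z p : E}
    (hz : z ∈ intrinsicInterior ℝ S) (hp : p ∈ affineSpan ℝ S) :
    ∃ δ : ℝ, 0 < δ ∧ z + δ • (z - p) ∈ S := by
  obtain ⟨y, hy, rfl⟩ := mem_intrinsicInterior.1 hz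
  obtain ⟨U, hU, hUS⟩ := isOpen_induced_iff.1
    (isOpen_interior (s := ((↑) ⁻¹' S : Set (affineSpan ℝ S))))
  have hyU : (y : E) ∈ U := by
    rw [← hUS] at hy
    exact hy
  obtain ⟨δ, hδ, hmem⟩ := exists_add_smul_mem_of_mem_nhds (hU.mem_nhds hyU) ((y : E) - p)
  refine ⟨δ, hδ, ?_⟩
  have hspan : (y : E) + δ • ((y : E) - p) ∈ affineSpan ℝ S := by
    have := AffineSubspace.vadd_mem_of_mem_direction
      ((affineSpan ℝ S).direction.smul_mem δ (AffineSubspace.vsub_mem_direction y.2 hp)) y.2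
    rwa [vadd_eq_add, vsub_eq_sub, add_comm] at this
  have : (⟨_, hspan⟩ : affineSpan ℝ S) ∈ interior ((↑) ⁻¹' S : Set (affineSpan ℝ S)) := by
    rw [← hUS]
    exact hmem
  have h := interior_subset (s := ((↑) ⁻¹' S : Set (affineSpan ℝ S))) this
  exact h

/-- A linear inequality valid on `S` and strict somewhere on its affine span is strict on the
relative interior. -/
theorem lt_of_mem_intrinsicInterior {S : Set E} {l : E →L[ℝ] ℝ} {b : ℝ} {z p : E}
    (hS : ∀ w ∈ S, l w ≤ b) (hz : z ∈ intrinsicInterior ℝ S) (hp : p ∈ affineSpan ℝ S)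
    (hlt : l p < b) : l z < b := by
  obtain ⟨δ, hδ, hmem⟩ := exists_add_smul_sub_mem_of_mem_intrinsicInterior hz hp
  have h := hS _ hmem
  simp only [map_add, map_smul, map_sub, smul_eq_mul] at h
  by_contra! hcon
  nlinarith

theorem lt_of_mem_interior {S : Set E} {l : E →L[ℝ] ℝ} {b : ℝ} {z p : E}
    (hS : ∀ w ∈ S, l w ≤ b) (hz : z ∈ interior S) (hlt : l p < b) : l z < b := by
  refine lt_of_mem_intrinsicInterior hS (interior_subset_intrinsicInterior hz) ?_ hlt
  have htop : affineSpan ℝ S = ⊤ := top_le_iff.1 <|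
    (isOpen_interior.affineSpan_eq_top ⟨z, hz⟩).symm.le.trans (affineSpan_mono ℝ interior_subset)
  simp [htop]

theorem vectorSpan_le_ker {S : Set E} {l : E →L[ℝ] ℝ} {b : ℝ} (hS : ∀ w ∈ S, l w = b) :
    vectorSpan ℝ S ≤ l.toLinearMap.ker := by
  rw [vectorSpan_def, Submodule.span_le]
  rintro _ ⟨x, hx, y, hy, rfl⟩
  simp [hS x hx, hS y hy]

theorem mem_intrinsicInterior_of_hyperplane {S U : Set E} {l : E →L[ℝ] ℝ} {b : ℝ} {z : E}
    (hS : ∀ w ∈ S, l w = b) (hU : IsOpen U) (hUS : ∀ w ∈ U, l w = b → w ∈ S) (hzU : z ∈ U)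
    (hz : z ∈ S) : z ∈ intrinsicInterior ℝ S := by
  refine mem_intrinsicInterior.2 ⟨⟨z, subset_affineSpan ℝ S hz⟩, ?_, rfl⟩
  have hzU' : (⟨z, subset_affineSpan ℝ S hz⟩ : affineSpan ℝ S) ∈
      ((↑) ⁻¹' U : Set (affineSpan ℝ S)) := hzU
  refine interior_maximal ?_ (hU.preimage continuous_subtype_val) hzU'
  rintro ⟨w, hw⟩ hwU
  refine hUS w hwU ?_
  have h := vectorSpan_le_ker hS (vsub_mem_vectorSpan_of_mem_affineSpan_of_mem_affineSpan hw
    (subset_affineSpan ℝ S hz))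
  rw [← hS z hz]
  simpa [sub_eq_zero] using h

theorem vectorSpan_eq_ker_of_hyperplane {S U : Set E} {l : E →L[ℝ] ℝ} {b : ℝ} {z : E}
    (hS : ∀ w ∈ S, l w = b) (hU : IsOpen U) (hUS : ∀ w ∈ U, l w = b → w ∈ S) (hzU : z ∈ U)
    (hz : z ∈ S) : vectorSpan ℝ S = l.toLinearMap.ker := by
  refine le_antisymm (vectorSpan_le_ker hS) fun v hv => ?_
  have hv0 : l v = 0 := hv
  obtain ⟨δ, hδ, hmem⟩ := exists_add_smul_mem_of_mem_nhds (hU.mem_nhds hzU) v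
  have h := vsub_mem_vectorSpan ℝ (hUS _ hmem (by simp [hv0, hS z hz])) hz
  have h2 := (vectorSpan ℝ S).smul_mem δ⁻¹ h
  simpa [smul_smul, inv_mul_cancel₀ hδ.ne'] using h2

theorem exists_eq_mul_of_ker_le {a l : E →L[ℝ] ℝ} (ha : a ≠ 0)
    (h : a.toLinearMap.ker ≤ l.toLinearMap.ker) : ∃ c : ℝ, ∀ x, l x = c * a x := by
  obtain ⟨u, hu⟩ := DFunLike.ne_iff.1 ha
  have hu : a u ≠ 0 := hu
  refine ⟨l u / a u, fun x => ?_⟩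
  have hx : x - (a x / a u) • u ∈ l.toLinearMap.ker := h (by simp [hu])
  have hx : l (x - (a x / a u) • u) = 0 := hx
  rw [map_sub, map_smul, smul_eq_mul, sub_eq_zero] at hx
  rw [hx]
  ring

theorem isOpen_strictSystem (H : Finset ((E →L[ℝ] ℝ) × ℝ)) :
    IsOpen {z : E | ∀ h ∈ H, h.1 z < h.2} := by
  simp only [Set.ofPred_forall]
  exact isOpen_biInter_finset fun h _ => isOpen_lt h.1.continuous continuous_const

theorem isClosed_system (H : Finset ((E →L[ℝ] ℝ) × ℝ)) :
    IsClosed {z : E | ∀ h ∈ H, h.1 z ≤ h.2} := by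
  simp only [Set.ofPred_forall]
  exact isClosed_biInter fun h _ => isClosed_le h.1.continuous continuous_const

theorem convex_system (H : Finset ((E →L[ℝ] ℝ) × ℝ)) :
    Convex ℝ {z : E | ∀ h ∈ H, h.1 z ≤ h.2} := by
  simp only [Set.ofPred_forall]
  exact convex_iInter₂ fun h _ => convex_halfSpace_le h.1.toLinearMap.isLinear _

/-- In an inclusion-minimal system, dropping an inequality enlarges the solution set; a new solution
is the witness. -/
theorem IsPolyhedron.exists_irredundant {C : Set E} (hC : IsPolyhedron C) :
    ∃ H : Finset ((E →L[ℝ] ℝ) × ℝ), C = {z | ∀ h ∈ H, h.1 z ≤ h.2} ∧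
      ∀ i ∈ H, ∃ w, i.2 < i.1 w ∧ ∀ h ∈ H, h ≠ i → h.1 w ≤ h.2 := by
  classical
  obtain ⟨H, hH⟩ := exists_minimal_of_wellFoundedLT
    (fun H : Finset ((E →L[ℝ] ℝ) × ℝ) => C = {z | ∀ h ∈ H, h.1 z ≤ h.2}) hC
  refine ⟨H, hH.prop, fun i hi => ?_⟩
  by_contra! hcon
  refine Finset.notMem_erase i H (hH.le_of_le (y := H.erase i) ?_ (Finset.erase_subset _ _) hi)
  have h1 := hH.prop
  change C = _ at h1
  rw [h1]
  ext z
  refine ⟨fun hz h hh => hz h (Finset.mem_of_mem_erase hh), fun hz h hh => ?_⟩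
  by_cases hhi : h = i
  · subst hhi
    by_contra! hlt
    obtain ⟨h', hh', hne, hlt'⟩ := hcon z hlt
    exact absurd (hz h' (Finset.mem_erase.2 ⟨hne, hh'⟩)) hlt'.not_ge
  · exact hz h (Finset.mem_erase.2 ⟨hhi, hh⟩)

/-- Separating each point of the finite set `S` from a maximal `S`-free set `C` describes `C` by
finitely many inequalities. -/
theorem IsMaximalFree.isPolyhedron {S C : Set E} (hS : S.Finite) (hint : (interior C).Nonempty)
    (hC : IsMaximalFree S C) : IsPolyhedron C := by
  classical
  have hfree : IsFree S C := hC.prop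
  have hsep : ∀ z ∈ S, ∃ l : E →L[ℝ] ℝ, ∀ x ∈ interior C, l x < l z := by
    intro z hz
    refine geometric_hahn_banach_open_point hfree.convex.interior isOpen_interior fun hzC => ?_
    exact (hfree.disjoint ▸ (⟨hzC, hz⟩ : z ∈ interior C ∩ S) : z ∈ (∅ : Set E))
  choose! l hl using hsep
  obtain ⟨p, hp⟩ := hint
  refine ⟨hS.toFinset.image fun z => (l z, l z z), ?_⟩
  set H := hS.toFinset.image fun z => (l z, l z z) with hH
  have hCH : C ⊆ {z | ∀ h ∈ H, h.1 z ≤ h.2} := by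
    intro x hx h hh
    obtain ⟨z, hz, rfl⟩ := Finset.mem_image.1 hh
    have hz : z ∈ S := hS.mem_toFinset.1 hz
    have hxc : x ∈ closure (interior C) := by
      rw [hfree.convex.closure_interior_eq_closure_of_nonempty_interior ⟨p, hp⟩]
      exact subset_closure hx
    exact closure_minimal (t := {x | l z x ≤ l z z}) (fun y hy => (hl z hz y hy).le)
      (isClosed_le (l z).continuous continuous_const) hxc
  -- By maximality it suffices that the system is free: each `z` in `S` attains equality in its own
  -- inequality, which is strict at `p`.
  refine hCH.antisymm (hC.le_of_ge ⟨isClosed_system H, convex_system H, ?_⟩ hCH)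
  refine eq_empty_of_forall_notMem fun z ⟨hzH, hz⟩ => ?_
  exact lt_irrefl (l z z) (lt_of_mem_interior
    (S := {z | ∀ h ∈ H, h.1 z ≤ h.2}) (fun w hw => hw (l z, l z z)
    (Finset.mem_image_of_mem _ (hS.mem_toFinset.2 hz))) hzH (hl z hz p hp))

variable [FiniteDimensional ℝ E]

/-- In an irredundant description each inequality defines a facet, and some point of the facet
satisfies all other inequalities strictly. -/
theorem isFacet_of_irredundant {C : Set E} {H : Finset ((E →L[ℝ] ℝ) × ℝ)}
    (hC : C = {z | ∀ h ∈ H, h.1 z ≤ h.2})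
    (hH : ∀ i ∈ H, ∃ w, i.2 < i.1 w ∧ ∀ h ∈ H, h ≠ i → h.1 w ≤ h.2)
    {p : E} (hp : p ∈ interior C) {i : (E →L[ℝ] ℝ) × ℝ} (hi : i ∈ H) :
    IsFacet C {z ∈ C | i.1 z = i.2} ∧
      ∃ y, (y ∈ C ∧ i.1 y = i.2) ∧ ∀ h ∈ H, h ≠ i → h.1 y < h.2 := by
  classical
  have hval : ∀ h ∈ H, ∀ w ∈ C, h.1 w ≤ h.2 := fun h hh w hw => by
    rw [hC] at hw
    exact hw h hh
  have hpC : p ∈ C := interior_subset hp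
  have hstrict : ∀ h ∈ H, h.1 p < h.2 := by
    intro h hh
    obtain ⟨w, hw, -⟩ := hH h hh
    obtain ⟨δ, hδ, hmem⟩ :=
      exists_add_smul_mem_of_mem_nhds (mem_interior_iff_mem_nhds.1 hp) (w - p)
    have h1 := hval h hh _ hmem
    simp only [map_add, map_smul, map_sub, smul_eq_mul] at h1
    by_contra! hcon
    have h2 := hval h hh p hpC
    nlinarith
  obtain ⟨w, hw, hwo⟩ := hH i hi
  have hpi := hstrict i hi
  have hden : 0 < i.1 w - i.1 p := by linarith
  -- The segment from `p` to `w` crosses the hyperplane of `i` at parameter `t`.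
  set t : ℝ := (i.2 - i.1 p) / (i.1 w - i.1 p) with ht
  have ht0 : 0 < t := div_pos (by linarith) hden
  have ht1 : t < 1 := (div_lt_one hden).2 (by linarith)
  have hexp : ∀ l : E →L[ℝ] ℝ, l (p + t • (w - p)) = (1 - t) * l p + t * l w := by
    intro l
    simp only [map_add, map_smul, map_sub, smul_eq_mul]
    ring
  have hyi : i.1 (p + t • (w - p)) = i.2 := by
    have : t * (i.1 w - i.1 p) = i.2 - i.1 p := div_mul_cancel₀ _ hden.ne'
    rw [hexp]
    linarith
  have hyo : ∀ h ∈ H, h ≠ i → h.1 (p + t • (w - p)) < h.2 := by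
    intro h hh hne
    rw [hexp]
    nlinarith [hstrict h hh, hwo h hh hne]
  have hyC : p + t • (w - p) ∈ C := by
    rw [hC]
    intro h hh
    by_cases hne : h = i
    · rw [hne, hyi]
    · exact (hyo h hh hne).le
  refine ⟨⟨⟨_, hyC, hyi⟩, fun _ => ⟨i.1, ?_⟩, ?_⟩, _, ⟨hyC, hyi⟩, hyo⟩
  · ext z
    refine ⟨fun hz => ⟨hz.1, fun x hx => hz.2 ▸ hval i hi x hx⟩, fun hz => ⟨hz.1, ?_⟩⟩
    exact le_antisymm (hval i hi z hz.1) (hyi ▸ hz.2 _ hyC)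
  · have htop : vectorSpan ℝ C = ⊤ := by
      have := (isOpen_interior.affineSpan_eq_top ⟨p, hp⟩)
      rw [← direction_affineSpan, top_le_iff.1 (this.symm.le.trans
        (affineSpan_mono ℝ interior_subset)), AffineSubspace.direction_top]
    have hi0 : i.1.toLinearMap ≠ 0 := by
      intro h0
      have h1 : ∀ x, i.1 x = 0 := fun x => LinearMap.congr_fun h0 x
      simp [h1] at hden
    rw [htop, finrank_top, vectorSpan_eq_ker_of_hyperplane (S := {z ∈ C | i.1 z = i.2})
      (l := i.1) (b := i.2) (fun z hz => hz.2) (isOpen_strictSystem (H.erase i)) (fun z hz hzi => ⟨?_, hzi⟩)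
      (fun h hh => hyo h (Finset.mem_of_mem_erase hh) (Finset.ne_of_mem_erase hh)) ⟨hyC, hyi⟩]
    · exact Module.Dual.finrank_ker_add_one_of_ne_zero hi0
    · rw [hC]
      intro h hh
      by_cases hne : h = i
      · rw [hne, hzi]
      · exact (hz h (Finset.mem_erase.2 ⟨hne, hh⟩)).le

/-- A full-dimensional polyhedron each of whose facets has a point of `S` in its relative interior
is not properly contained in an `S`-free set. -/
theorem IsFree.subset_of_facets_meet {S C D : Set E} (hpoly : IsPolyhedron C)
    (hint : (interior C).Nonempty)
    (hfacet : ∀ F, IsFacet C F → (S ∩ intrinsicInterior ℝ F).Nonempty)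
    (hD : IsFree S D) (hCD : C ⊆ D) : D ⊆ C := by
  classical
  obtain ⟨H, hC, hH⟩ := hpoly.exists_irredundant
  obtain ⟨p, hp⟩ := hint
  intro d hd
  by_contra hdC
  have : ∃ i ∈ H, i.2 < i.1 d := by
    by_contra! hcon
    exact hdC (hC ▸ hcon)
  obtain ⟨i, hi, hdi⟩ := this
  obtain ⟨hF, y, hy, hyo⟩ := isFacet_of_irredundant hC hH hp hi
  obtain ⟨z, hzS, hz⟩ := hfacet _ hF
  have hzF := intrinsicInterior_subset hz
  have hzo : z ∈ {x : E | ∀ h ∈ H.erase i, h.1 x < h.2} := by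
    intro h hh
    refine lt_of_mem_intrinsicInterior (fun w hw => ?_) hz (subset_affineSpan ℝ _ hy)
      (hyo h (Finset.mem_of_mem_erase hh) (Finset.ne_of_mem_erase hh))
    have hwC := hw.1
    rw [hC] at hwC
    exact hwC h (Finset.mem_of_mem_erase hh)
  -- Overshooting `z` away from `d` enters `interior C`: constraint `i` becomes strict because `d`
  -- violates it. So `z` lies strictly between an interior point of `D` and `d`.
  obtain ⟨δ, hδ, hmem⟩ :=
    exists_add_smul_mem_of_mem_nhds ((isOpen_strictSystem _).mem_nhds hzo) (z - d)
  have hq : z + δ • (z - d) ∈ interior C := by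
    refine mem_interior.2 ⟨{x | ∀ h ∈ H, h.1 x < h.2}, ?_, isOpen_strictSystem H, ?_⟩
    · rw [hC]
      exact fun x hx h hh => (hx h hh).le
    · intro h hh
      by_cases hne : h = i
      · subst hne
        simp only [map_add, map_smul, map_sub, smul_eq_mul, hzF.2]
        nlinarith
      · exact hmem h (Finset.mem_erase.2 ⟨hne, hh⟩)
  have hzD : z ∈ interior D := by
    refine hD.convex.openSegment_interior_self_subset_interior (interior_mono hCD hq) hd ?_
    refine ⟨1 / (1 + δ), δ / (1 + δ), by positivity, by positivity, by field_simp, ?_⟩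
    have h1 : (1 / (1 + δ)) * δ = δ / (1 + δ) := by ring
    have h2 : 1 / (1 + δ) + δ / (1 + δ) = 1 := by field_simp
    rw [smul_add, smul_smul, h1, smul_sub, add_assoc, sub_add_cancel, ← add_smul, h2, one_smul]
  exact (hD.disjoint ▸ (⟨hzD, hzS⟩ : z ∈ interior D ∩ S) : z ∈ (∅ : Set E))

/-- Every facet of a polyhedral maximal `S`-free set with `S` finite has a point of `S` in its
relative interior: otherwise the facet inequality could be relaxed. -/
theorem IsMaximalFree.facet_meets {S C F : Set E} (hS : S.Finite)
    (hfull : affineSpan ℝ C = ⊤) (hC : IsMaximalFree S C)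
    (hpoly : IsPolyhedron C) (hF : IsFacet C F) : (S ∩ intrinsicInterior ℝ F).Nonempty := by
  classical
  have hfree : IsFree S C := hC.prop
  obtain ⟨H, hH⟩ := hpoly
  obtain ⟨hne, hexp, hdim⟩ := hF
  obtain ⟨a, ha⟩ := hexp hne
  obtain ⟨q, hq⟩ := id hne
  have hFC : F ⊆ C := fun x hx => by
    rw [ha] at hx
    exact hx.1
  have haC : ∀ x ∈ C, a x ≤ a q := by
    rw [ha] at hq
    exact hq.2
  have hFa : ∀ x, x ∈ F ↔ x ∈ C ∧ a x = a q := by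
    intro x
    refine ⟨fun hx => ⟨hFC hx, (haC x (hFC hx)).antisymm ?_⟩, fun hx => ?_⟩
    · rw [ha] at hx
      exact hx.2 q (hFC hq)
    · rw [ha]
      exact ⟨hx.1, fun y hy => hx.2 ▸ haC y hy⟩
  have hpos : ∃ w ∈ C, a w < a q := by
    by_contra! hcon
    have : F = C := hFC.antisymm fun x hx => (hFa x).2 ⟨hx, (haC x hx).antisymm (hcon x hx)⟩
    rw [this] at hdim
    omega
  obtain ⟨w, hwC, hw⟩ := hpos
  have ha0 : a ≠ 0 := by
    rintro rfl
    simp at hw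
  have hspan : vectorSpan ℝ F = a.toLinearMap.ker := by
    refine Submodule.eq_of_le_of_finrank_eq (vectorSpan_le_ker fun x hx => ((hFa x).1 hx).2) ?_
    have h1 : a.toLinearMap ≠ 0 := fun h => ha0 (ContinuousLinearMap.ext (LinearMap.congr_fun h))
    have h2 := Module.Dual.finrank_ker_add_one_of_ne_zero (f := a.toLinearMap) h1
    rw [← direction_affineSpan ℝ C, hfull, AffineSubspace.direction_top, finrank_top] at hdim
    omega
  have hconvF : Convex ℝ F := by
    have : F = C ∩ {x | a x = a q} := Set.ext fun x => hFa x
    rw [this]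
    exact hfree.convex.inter (convex_hyperplane a.toLinearMap.isLinear _)
  obtain ⟨y, hy⟩ := Set.Nonempty.intrinsicInterior hconvF hne
  have hyF := intrinsicInterior_subset hy
  have hval : ∀ h ∈ H, ∀ x ∈ C, h.1 x ≤ h.2 := fun h hh x hx => by
    rw [hH] at hx
    exact hx h hh
  -- An inequality tight at the relative interior point `y` is tight on all of `F`, hence a multiple
  -- of the facet inequality; `w` shows that the factor is nonnegative.
  have htight : ∀ h ∈ H, h.1 y = h.2 → ∀ x, a x ≤ a q → h.1 x ≤ h.2 := by
    intro h hh hhy x hx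
    have hconst : ∀ x ∈ F, h.1 x = h.2 := by
      intro x hx
      by_contra hcon
      exact (lt_of_mem_intrinsicInterior (fun u hu => hval h hh u (hFC hu)) hy
        (subset_affineSpan ℝ F hx) ((hval h hh x (hFC hx)).lt_of_ne hcon)).ne hhy
    obtain ⟨c, hc⟩ := exists_eq_mul_of_ker_le ha0 (hspan ▸ vectorSpan_le_ker hconst)
    have h1 := hconst q hq
    have h2 := hval h hh w hwC
    rw [← h1, hc, hc] at h2 ⊢
    have hc0 : 0 ≤ c := by
      by_contra! hneg
      nlinarith
    exact mul_le_mul_of_nonneg_left hx hc0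
  -- Finiteness of `S` leaves a thin slab beyond the facet hyperplane free of its points.
  obtain ⟨ε, hε, hεS⟩ : ∃ ε : ℝ, 0 < ε ∧ ∀ z ∈ S, a z ≤ a q + ε → a z ≤ a q := by
    have hev : ∀ z ∈ S, ∀ᶠ ε : ℝ in 𝓝[>] 0, a z ≤ a q + ε → a z ≤ a q := by
      intro z _
      by_cases hz : a z ≤ a q
      · exact Eventually.of_forall fun _ _ => hz
      · have : Iio (a z - a q) ∈ 𝓝[>] (0 : ℝ) :=
          mem_nhdsWithin_of_mem_nhds (Iio_mem_nhds (by linarith))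
        filter_upwards [this] with ε hε h
        have : ε < a z - a q := hε
        linarith
    obtain ⟨ε, h, hε⟩ := (((eventually_all_finite hS).2 hev).and self_mem_nhdsWithin).exists
    exact ⟨ε, hε, h⟩
  -- Only constraints slack at `y` are kept, and the facet inequality is relaxed by `ε`, so `y`
  -- becomes interior to `D`.
  set H₂ := H.filter fun h => h.1 y < h.2 with hH₂
  set D : Set E := {x | ∀ h ∈ insert (a, a q + ε) H₂, h.1 x ≤ h.2} with hD
  have hDa : ∀ x ∈ D, a x ≤ a q + ε := fun x hx => hx (a, a q + ε) (Finset.mem_insert_self _ _)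
  have hCD : C ⊆ D := by
    intro x hx h hh
    rcases Finset.mem_insert.1 hh with rfl | hh
    · exact (haC x hx).trans (by simpa using hε.le)
    · exact hval h (Finset.mem_filter.1 hh).1 x hx
  have hmemC : ∀ x, a x ≤ a q → (∀ h ∈ H₂, h.1 x < h.2) → x ∈ C := by
    intro x hx hx₂
    rw [hH]
    intro h hh
    by_cases hhy : h.1 y < h.2
    · exact (hx₂ h (Finset.mem_filter.2 ⟨hh, hhy⟩)).le
    · exact htight h hh ((hval h hh y (hFC hyF)).antisymm (not_lt.1 hhy)) x hx
  have hDnotfree : ¬ IsFree S D := by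
    intro hDfree
    have hyD : y ∈ interior D := by
      refine mem_interior.2 ⟨{x | ∀ h ∈ insert (a, a q + ε) H₂, h.1 x < h.2},
        fun x hx h hh => (hx h hh).le, isOpen_strictSystem _, fun h hh => ?_⟩
      rcases Finset.mem_insert.1 hh with rfl | hh
      · simpa [((hFa y).1 hyF).2] using hε
      · exact (Finset.mem_filter.1 hh).2
    have hyC : y ∈ interior C := interior_mono (hC.le_of_ge hDfree hCD) hyD
    exact (lt_of_mem_interior haC hyC hw).ne ((hFa y).1 hyF).2
  obtain ⟨z, hzD, hzS⟩ : (interior D ∩ S).Nonempty := by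
    by_contra hcon
    exact hDnotfree ⟨isClosed_system _, convex_system _, not_nonempty_iff_eq_empty.1 hcon⟩
  have hza : a z ≤ a q := hεS z hzS (hDa z (interior_subset hzD))
  have hz₂ : ∀ h ∈ H₂, h.1 z < h.2 := fun h hh =>
    lt_of_mem_interior (S := D) (fun x hx => hx h (Finset.mem_insert_of_mem hh)) hzD
      (Finset.mem_filter.1 hh).2
  refine ⟨z, hzS, ?_⟩
  rcases hza.lt_or_eq with hlt | heq
  · exfalso
    have hzC : z ∈ interior C := mem_interior.2
      ⟨{x | a x < a q} ∩ {x | ∀ h ∈ H₂, h.1 x < h.2}, fun x hx => hmemC x hx.1.le hx.2,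
        (isOpen_lt a.continuous continuous_const).inter (isOpen_strictSystem H₂), hlt, hz₂⟩
    exact (hfree.disjoint ▸ (⟨hzC, hzS⟩ : z ∈ interior C ∩ S) : z ∈ (∅ : Set E))
  · exact mem_intrinsicInterior_of_hyperplane (fun x hx => ((hFa x).1 hx).2)
      (isOpen_strictSystem H₂) (fun x hx hxa => (hFa x).2 ⟨hmemC x hxa.le hx, hxa⟩) hz₂
      ((hFa z).2 ⟨hmemC z hza hz₂, heq⟩)

end Polyhedra

/-! ### Passing from the hypograph to the graph. -/

theorem cube_finite (n : ℕ) : (cube n).Finite := by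
  have : cube n = Set.pi univ fun _ => ({0, 1} : Set ℝ) := by
    ext x
    simp [cube]
  rw [this]
  exact Set.Finite.pi fun _ => toFinite _

theorem graCube_finite {n : ℕ} (f : (Fin n → ℝ) → ℝ) : (graCube f).Finite :=
  ((cube_finite n).image fun x => (x, f x)).subset fun p hp => ⟨p.1, hp.1, Prod.ext rfl hp.2⟩

theorem graCube_subset_hypCube {n : ℕ} (f : (Fin n → ℝ) → ℝ) : graCube f ⊆ hypCube f :=
  fun _ hp => ⟨hp.1, hp.2.ge⟩

theorem vertical_mem_extendedEnvelopeEpigraph {n : ℕ} (f : (Fin n → ℝ) → ℝ) {t : ℝ} (ht : 0 ≤ t) :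
    ((0, t) : (Fin n → ℝ) × ℝ) ∈ extendedEnvelopeEpigraph f := fun s _ => by simpa using ht

theorem IsFree.mono_right {E : Type*} [AddCommGroup E] [Module ℝ E] [TopologicalSpace E]
    {S T C : Set E} (hST : S ⊆ T) (h : IsFree T C) : IsFree S C :=
  ⟨h.isClosed, h.convex, subset_empty_iff.1 (h.disjoint ▸ inter_subset_inter_right _ hST)⟩

/-- A closed convex set containing the upward ray from the origin has the upward direction as a
recession direction, hence its interior is closed under moving upward. -/
theorem interior_upward {n : ℕ} {C : Set ((Fin n → ℝ) × ℝ)}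
    (hconv : Convex ℝ C) (hray : ∀ t : ℝ, 0 ≤ t → (0, t) ∈ C) {x : Fin n → ℝ} {t u : ℝ}
    (h : (x, t) ∈ interior C) (htu : t ≤ u) : (x, u) ∈ interior C := by
  obtain ⟨δ, hδ, hmem⟩ :=
    exists_add_smul_mem_of_mem_nhds (isOpen_interior.mem_nhds h) ((x, t) : (Fin n → ℝ) × ℝ)
  -- Weighted by `δ / (1 + δ)`, this height contributes exactly `u - t`.
  have hr := hray ((u - t) * (1 + δ) / δ)
    (div_nonneg (mul_nonneg (sub_nonneg.2 htu) (by positivity)) hδ.le)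
  refine hconv.openSegment_interior_self_subset_interior hmem hr
    ⟨1 / (1 + δ), δ / (1 + δ), by positivity, by positivity, by field_simp, ?_⟩
  ext i
  · simp
    field_simp
  · simp
    field_simp
    ring

theorem isFree_hypCube_iff {n : ℕ} {f : (Fin n → ℝ) → ℝ} {C : Set ((Fin n → ℝ) × ℝ)}
    (hC : extendedEnvelopeEpigraph f ⊆ C) :
    IsFree (hypCube f) C ↔ IsFree (graCube f) C := by
  refine ⟨IsFree.mono_right (graCube_subset_hypCube f), fun h => ⟨h.isClosed, h.convex, ?_⟩⟩
  refine eq_empty_of_forall_notMem fun p ⟨hpC, hp⟩ => ?_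
  have hmem : (p.1, f p.1) ∈ interior C ∩ graCube f :=
    ⟨interior_upward h.convex (fun t ht => hC (vertical_mem_extendedEnvelopeEpigraph f ht)) hpC
      hp.2, hp.1, rfl⟩
  rw [h.disjoint] at hmem
  exact hmem

/-- Every competitor contains `C`, hence the epigraph, so `isFree_hypCube_iff` applies to it too. -/
theorem isMaximalFree_hypCube_iff {n : ℕ} {f : (Fin n → ℝ) → ℝ} {C : Set ((Fin n → ℝ) × ℝ)}
    (hC : extendedEnvelopeEpigraph f ⊆ C) :
    IsMaximalFree (hypCube f) C ↔ IsMaximalFree (graCube f) C :=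
  ⟨fun h => ⟨(isFree_hypCube_iff hC).1 h.prop, fun _ hD hCD =>
      h.le_of_ge ((isFree_hypCube_iff (hC.trans hCD)).2 hD) hCD⟩,
    fun h => ⟨(isFree_hypCube_iff hC).2 h.prop, fun _ hD hCD =>
      h.le_of_ge ((isFree_hypCube_iff (hC.trans hCD)).1 hD) hCD⟩⟩

end SubmodularFree

theorem mainTheorem1 {n : ℕ} (f : (Fin n → ℝ) → ℝ)
    (hf : SubmodularFree.IsSubmodularOnCube f) (hf0 : f 0 = 0)
    (C : Set ((Fin n → ℝ) × ℝ)) (hclosed : IsClosed C) (hconv : Convex ℝ C)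
    (hfull : affineSpan ℝ C = ⊤)
    (hC : SubmodularFree.extendedEnvelopeEpigraph f ⊆ C) :
    (SubmodularFree.IsFree (SubmodularFree.hypCube f) C ↔
      SubmodularFree.IsFree (SubmodularFree.graCube f) C) ∧
    (SubmodularFree.IsMaximalFree (SubmodularFree.hypCube f) C ↔
      SubmodularFree.IsFree (SubmodularFree.hypCube f) C ∧
      SubmodularFree.IsPolyhedron C ∧
      ∀ F : Set ((Fin n → ℝ) × ℝ), SubmodularFree.IsFacet C F →
        (SubmodularFree.graCube f ∩ intrinsicInterior ℝ F).Nonempty) := by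
  have hint := hconv.interior_nonempty_iff_affineSpan_eq_top.2 hfull
  refine ⟨SubmodularFree.isFree_hypCube_iff hC, fun h => ⟨h.prop, ?_⟩, fun h => ⟨h.1, ?_⟩⟩
  · have hgra := (SubmodularFree.isMaximalFree_hypCube_iff hC).1 h
    have hfin := SubmodularFree.graCube_finite f
    have hpoly := hgra.isPolyhedron hfin hint
    exact ⟨hpoly, fun F hF => hgra.facet_meets hfin hfull hpoly hF⟩
  · exact fun D hD hCD => SubmodularFree.IsFree.subset_of_facets_meet h.2.1 hint h.2.2
      (hD.mono_right (SubmodularFree.graCube_subset_hypCube f)) hCD
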